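/- Let $N$ be a simply connected, 2-step nilpotent Lie group with a left invariant Riemannian metric, let $\mathfrak N$ be its Lie algebra with the corresponding inner product $\langle\,,\rangle$ (so $[[X,Y],W]=0$ for all $X,Y,W\in\mathfrak N$ and $\mathfrak N$ is not abelian), and suppose that $\mathfrak N$ is of type $(p,q)$: $[\mathfrak N,\mathfrak N]$ has dimension $p$ and codimension $q$ in $\mathfrak N$. Put $P=\lfloor q/2\rfloor$. Let $Z\in[\mathfrak N,\mathfrak N]$ be nonzero, let $\gamma_Z(t)=\exp(tZ)$, and let $j(Z)$ be the skew symmetric linear map of the $q$-dimensional space $[\mathfrak N,\mathfrak N]^\perp$ given by $\langle j(Z)X,Y\rangle=\langle[X,Y],Z\rangle$. Its eigenvalues are the complex roots of its characteristic polynomial, counted with multiplicity. A conjugate value of $\gamma_Z$ is a $t>0$ such that some Jacobi field along $\gamma_Z$ that is not identically zero vanishes at $0$ and at $t$; it is primitive if it is not of the form $mt_0$ with an integer $m\ge 2$ and a conjugate value $t_0$. Then: 1. $\gamma_Z$ has at most $P$ primitive conjugate values. 2. $\gamma_Z$ has exactly $P$ primitive conjugate values if and only if the eigenvalues of $j(Z)$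 are all distinct and no ratio of two distinct nonzero eigenvalues of $j(Z)$ is an integer of absolute value $\ge 2$. 3. If $t_1,\dots,t_P$ are distinct primitive conjugate values of $\gamma_Z$, then there are $\lambda_1,\dots,\lambda_P>0$ such that, for every $k$, $t_k=2\pi/\lambda_k$ and $i\lambda_k$ is an eigenvalue of $j(Z)$, and the nonzero eigenvalues of $j(Z)$ are exactly $\pm i\lambda_1,\dots,\pm i\lambda_P$. 4. Consequently, if $\gamma_Z$ has exactly $P$ primitive conjugate values, then $q$ and the set of conjugate values of $\gamma_Z$ determine the eigenvalues of $j(Z)$ with their multiplicities: they are all simple, the nonzero ones are exactly the numbers $\pm 2\pi i/t$ with $t$ a primitive conjugate value, and $0$ is an eigenvalue if and only if $q$ is odd. -/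

import Mathlib

open scoped Manifold ContDiff Bundle
open Bundle (RiemannianBundle)

/-! ### Lie algebras -/

section LieAlgebras

variable (L : Type*) [LieRing L] [LieAlgebra ℝ L]

/-- The commutator subalgebra `[L, L]`, as a linear subspace of `L`. -/
def commutatorSubspace : Submodule ℝ L :=
  (⁅(⊤ : LieIdeal ℝ L), (⊤ : LieIdeal ℝ L)⁆ : LieIdeal ℝ L).toSubmodule

/-- `L` is a 2-step nilpotent Lie algebra: `[[x, y], z] = 0` for all `x, y, z`, but `L` is not
abelian. -/
def IsTwoStepNilpotent : Prop :=
  (∀ x y z : L, ⁅⁅x, y⁆, z⁆ = 0) ∧ ¬ IsLieAbelian L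

/-- `L` is of type `(p, q)`: `[L, L]` has dimension `p` and codimension `q` in `L`. -/
def IsOfType (p q : ℕ) : Prop :=
  Module.finrank ℝ (commutatorSubspace L) = p ∧
    Module.finrank ℝ (L ⧸ commutatorSubspace L) = q

end LieAlgebras

noncomputable section

/-! ### Lie groups with a left invariant metric, connections, curvature -/

section Geometry

variable {E : Type*} [NormedAddCommGroup E] [NormedSpace ℝ E]
  {H : Type*} [TopologicalSpace H] (I : ModelWithCorners ℝ E H)
  {N : Type*} [TopologicalSpace N] [ChartedSpace H N] [Group N]

/-- A smooth real Lie group has the regularity that Mathlib uses for its Lie algebra. -/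
instance instLieGroupMinSmoothness [LieGroup I ∞ N] : LieGroup I (minSmoothness ℝ 3) N := by
  rw [minSmoothness_of_isRCLikeNormedField]
  infer_instance

variable {I}

/-- The value at the identity of the left invariant vector field with value `u` at `x`,
that is, the image of `u ∈ T_x N` under the differential of left translation by `x⁻¹`. -/
def leftPullback (x : N) (u : TangentSpace I x) : GroupLieAlgebra I N :=
  (mfderiv I I (fun y : N ↦ x⁻¹ * y) x u : E)

/-- The left invariant vector field with value `u` at `x`. -/
def leftInvariantExtension (x : N) (u : TangentSpace I x) (y : N) : TangentSpace I y :=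
  mulInvariantVectorField (leftPullback x u) y

/-- The velocity `γ'(t)` of a curve in `N`. -/
def velocity (γ : ℝ → N) (t : ℝ) : TangentSpace I (γ t) :=
  mfderiv 𝓘(ℝ, ℝ) I γ t (1 : ℝ)

variable (I N) in
/-- The Riemannian metric is left invariant: every left translation is an isometry. -/
def IsLeftInvariantMetric [RiemannianBundle (TangentSpace I : N → Type _)] : Prop :=
  ∀ (g x : N) (u v : TangentSpace I x),
    inner ℝ (mfderiv I I (fun y : N ↦ g * y) x u) (mfderiv I I (fun y : N ↦ g * y) x v) =
      inner ℝ u v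

/-- `γ` is the curve `t ↦ exp (t Z)`: the integral curve, starting at the identity, of the left
invariant vector field with value `Z` at the identity. -/
def IsExpCurve (Z : GroupLieAlgebra I N) (γ : ℝ → N) : Prop :=
  γ 0 = 1 ∧ IsMIntegralCurve γ (mulInvariantVectorField Z : (x : N) → TangentSpace I x)

/-- `D` is the Levi-Civita connection: metric and torsion free. -/
def IsLeviCivita [FiniteDimensional ℝ E] [CompleteSpace E] [LieGroup I ∞ N]
    [RiemannianBundle (TangentSpace I : N → Type _)]
    [IsContMDiffRiemannianBundle I ∞ E (TangentSpace I : N → Type _)]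
    (D : CovariantDerivative I E (TangentSpace I : N → Type _)) : Prop :=
  CovariantDerivative.IsMetricCompatible (V := (TangentSpace I : N → Type _)) D ∧
    D.torsion = 0

variable [LieGroup I ∞ N] (D : CovariantDerivative I E (TangentSpace I : N → Type _))

/-- The curvature `R(X, Y) W = ∇_X ∇_Y W - ∇_Y ∇_X W - ∇_{[X, Y]} W` on vector fields. -/
def curvatureField (X Y W : (x : N) → TangentSpace I x) (x : N) : TangentSpace I x :=
  D (fun y ↦ D W y (Y y)) x (X x) - D (fun y ↦ D W y (X y)) x (Y x)
    - D W x (VectorField.mlieBracket I X Y x)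

/-- The curvature `R(u, v) w` of tangent vectors at `x`. Curvature is a tensor, so that any
extensions of `u, v, w` to smooth vector fields can be used; here these are the left invariant
ones. -/
def curvatureAt (x : N) (u v w : TangentSpace I x) : TangentSpace I x :=
  curvatureField D (leftInvariantExtension x u) (leftInvariantExtension x v)
    (leftInvariantExtension x w) x

/-- The components of a vector field `Y` along `γ` in the global frame of left invariant fields:
`y(t)` in the Lie algebra is such that `Y(t)` is the value at `γ(t)` of the left invariant field
determined by `y(t)`. -/
def frameComponents (γ : ℝ → N) (Y : (t : ℝ) → TangentSpace I (γ t)) (t : ℝ) :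
    GroupLieAlgebra I N :=
  leftPullback (γ t) (Y t)

/-- Smoothness of a vector field along a curve: its components in the global smooth frame of left
invariant fields are smooth. -/
def IsSmoothAlong (γ : ℝ → N) (Y : (t : ℝ) → TangentSpace I (γ t)) : Prop :=
  ContDiff ℝ ∞ (F := E) (frameComponents γ Y)

/-- The covariant derivative `Y'` of a vector field `Y` along `γ`. If `Y(t) = ∑ yᵢ(t) Aᵢ(γ(t))`
with left invariant vector fields `Aᵢ`, then
`Y'(t) = ∑ yᵢ'(t) Aᵢ(γ(t)) + ∑ yᵢ(t) (∇_{γ'(t)} Aᵢ)`. -/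
def covDerivAlong (γ : ℝ → N) (Y : (t : ℝ) → TangentSpace I (γ t)) (t : ℝ) :
    TangentSpace I (γ t) :=
  mulInvariantVectorField (deriv (frameComponents γ Y) t) (γ t) +
    D (mulInvariantVectorField (frameComponents γ Y t)) (γ t) (velocity γ t)

/-- `Y` is a Jacobi vector field along `γ`: `Y'' + R(Y, γ') γ' = 0`. -/
def IsJacobiField (γ : ℝ → N) (Y : (t : ℝ) → TangentSpace I (γ t)) : Prop :=
  IsSmoothAlong γ Y ∧ ∀ t : ℝ,
    covDerivAlong D γ (covDerivAlong D γ Y) t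
      + curvatureAt D (γ t) (Y t) (velocity γ t) (velocity γ t) = 0

/-- `t > 0` is a conjugate value of `γ`: `γ(t)` is conjugate to `γ(0)` along `γ`, i.e. some
Jacobi field along `γ` that is not identically zero vanishes at `0` and at `t`. -/
def IsConjugateValue (γ : ℝ → N) (t : ℝ) : Prop :=
  0 < t ∧ ∃ Y : (s : ℝ) → TangentSpace I (γ s),
    IsJacobiField D γ Y ∧ (∃ s, Y s ≠ 0) ∧ Y 0 = 0 ∧ Y t = 0

/-- The set of primitive conjugate values of `γ`: the conjugate values that are not of the form
`m * t₀` with an integer `m ≥ 2` and a conjugate value `t₀`. -/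
def primitiveConjugateValues (γ : ℝ → N) : Set ℝ :=
  {t | IsConjugateValue D γ t ∧
    ¬ ∃ (m : ℤ) (t₀ : ℝ), 2 ≤ m ∧ IsConjugateValue D γ t₀ ∧ t = m * t₀}

end Geometry

/-! ### The metric Lie algebra and the skew symmetric maps `j(Z)` -/

section SkewMap

variable {L : Type*} [LieRing L] [LieAlgebra ℝ L]

/-- `B` is a (positive definite) inner product. -/
structure IsInnerProduct (B : LinearMap.BilinForm ℝ L) : Prop where
  symm : ∀ x y, B x y = B y x
  pos : ∀ x, x ≠ 0 → 0 < B x x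

/-- The orthogonal complement of the commutator subalgebra with respect to `B`. -/
def horizontalSpace (B : LinearMap.BilinForm ℝ L) : Submodule ℝ L :=
  B.orthogonal (commutatorSubspace L)

theorem IsInnerProduct.nondegenerate_restrict {B : LinearMap.BilinForm ℝ L}
    (hB : IsInnerProduct B) (V : Submodule ℝ L) : (B.restrict V).Nondegenerate := by
  constructor
  · intro x hx
    by_contra hne
    exact (hB.pos x (by simpa using hne)).ne' (by simpa using hx x)
  · intro x hx
    by_contra hne
    exact (hB.pos x (by simpa using hne)).ne' (by simpa using hx x)

/-- The linear functionals `Y ↦ ⟨[X, Y], Z⟩` on the horizontal space, linear in `X`. -/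
def bracketForm (B : LinearMap.BilinForm ℝ L) (Z : L) :
    horizontalSpace B →ₗ[ℝ] Module.Dual ℝ (horizontalSpace B) :=
  LinearMap.mk₂ ℝ (fun X Y ↦ B ⁅(X : L), (Y : L)⁆ Z)
    (by intros; simp) (by intros; simp) (by intros; simp) (by intros; simp)

/-- The skew symmetric map `j(Z)` on the orthogonal complement of the commutator subalgebra,
given by `⟨j(Z) X, Y⟩ = ⟨[X, Y], Z⟩`. -/
def jMap [FiniteDimensional ℝ L] {B : LinearMap.BilinForm ℝ L} (hB : IsInnerProduct B) (Z : L) :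
    Module.End ℝ (horizontalSpace B) :=
  ((B.restrict (horizontalSpace B)).toDual (hB.nondegenerate_restrict _)).symm.toLinearMap ∘ₗ
    bracketForm B Z

theorem jMap_spec [FiniteDimensional ℝ L] {B : LinearMap.BilinForm ℝ L} (hB : IsInnerProduct B)
    (Z : L) (X Y : horizontalSpace B) :
    B (jMap hB Z X) Y = B ⁅(X : L), (Y : L)⁆ Z := by
  have h := LinearMap.BilinForm.apply_toDual_symm_apply
    (B := B.restrict (horizontalSpace B)) (hB := hB.nondegenerate_restrict _)
    (bracketForm B Z X) Y
  simpa [jMap, bracketForm] using h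

/-- The eigenvalues of `j(Z)`, with multiplicities: the complex roots of its characteristic
polynomial. -/
def jEigenvalues [FiniteDimensional ℝ L] {B : LinearMap.BilinForm ℝ L} (hB : IsInnerProduct B)
    (Z : L) : Multiset ℂ :=
  ((jMap hB Z).charpoly.map (algebraMap ℝ ℂ)).roots

end SkewMap

section MetricLieAlgebra

variable {E : Type*} [NormedAddCommGroup E] [NormedSpace ℝ E]
  {H : Type*} [TopologicalSpace H] (I : ModelWithCorners ℝ E H)
  (N : Type*) [TopologicalSpace N] [ChartedSpace H N]
  [RiemannianBundle (TangentSpace I : N → Type _)]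

/-- The inner product on the tangent space at `x` given by the Riemannian metric. -/
def metricAt (x : N) : LinearMap.BilinForm ℝ (TangentSpace I x) :=
  LinearMap.mk₂ ℝ (fun u v ↦ inner ℝ u v)
    (fun _ _ _ ↦ inner_add_left _ _ _) (fun _ _ _ ↦ real_inner_smul_left _ _ _)
    (fun _ _ _ ↦ inner_add_right _ _ _) (fun _ _ _ ↦ real_inner_smul_right _ _ _)

theorem metricAt_symm (x : N) (u v : TangentSpace I x) : metricAt I N x u v = metricAt I N x v u :=
  (real_inner_comm u v).symm

theorem metricAt_pos (x : N) (u : TangentSpace I x) (hu : u ≠ 0) : 0 < metricAt I N x u u :=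
  real_inner_self_pos.2 hu

variable [Group N]

/-- The inner product on the Lie algebra of `N` given by the Riemannian metric of `N`. -/
def metricForm [CompleteSpace E] [LieGroup I ∞ N] : LinearMap.BilinForm ℝ (GroupLieAlgebra I N) :=
  metricAt I N 1

theorem isInnerProduct_metricForm [CompleteSpace E] [LieGroup I ∞ N] :
    IsInnerProduct (metricForm I N) where
  symm := metricAt_symm I N 1
  pos := metricAt_pos I N 1

instance instFiniteDimensionalGroupLieAlgebra [FiniteDimensional ℝ E] :
    FiniteDimensional ℝ (GroupLieAlgebra I N) :=
  inferInstanceAs (FiniteDimensional ℝ E)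

end MetricLieAlgebra

end

/-! The commutator subspace is central, so `Z` is central. Let `J` be the skew map of the whole Lie
algebra with `⟨J X, Y⟩ = ⟨[X, Y], Z⟩`; it is `j(Z)` on the horizontal space and zero on the
commutator subspace. The Koszul argument gives `∇_Z Y = ∇_Y Z = -½ J Y` for left invariant `Y`,
whence `R(Y, Z) Z = -¼ J² Y`. In the left invariant frame the covariant derivative along `γ_Z` is
therefore `d/dt - ½ J`, the curvature cancels the zeroth order term, and the Jacobi equation becomes
`y'' = J y'` (`IsLeviCivita.isJacobiField_iff`).

The initial velocities of solutions vanishing at `0` and `t` form a `J`-invariant subspace. If it is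
nonzero, it contains some `e ≠ 0` with `J² e = -l² e`, and the explicit solution with velocity `e`
returns to zero at `t > 0` only if `l ≠ 0` and `l t ∈ 2πℤ`. Hence the conjugate values are the
numbers `2πk / l` with `k ≥ 1`, `l > 0` and `il` an eigenvalue of `j(Z)`
(`IsSkewFor.exists_vanishing_iff`).

The rest is counting. Primitive values are the `2π / l` for which no `ml`, `m ≥ 2`, is a frequency.
The spectrum is imaginary and symmetric under negation, so there are at most `⌊q/2⌋` frequencies;
reaching this bound means that the spectrum is simple and that no frequency is lost to resonance
(`IsSkewSpectrum.primitiveElements_conclusion`). -/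

/-! ### Multisets of purely imaginary numbers -/

section Combinatorics

/-- The positive multiples `2πk / l` of the periods `2π / l` of the frequencies `l` in `S`. -/
def resonanceTimes (S : Set ℝ) : Set ℝ :=
  {t | ∃ l ∈ S, ∃ k : ℕ, 1 ≤ k ∧ t = 2 * Real.pi * k / l}

/-- The elements of a set of real numbers that are not proper integral multiples of others. -/
def primitiveElements (C : Set ℝ) : Set ℝ :=
  {t | t ∈ C ∧ ¬ ∃ (m : ℤ) (t₀ : ℝ), 2 ≤ m ∧ t₀ ∈ C ∧ t = m * t₀}

/-- Since `2πk / l` is `k` times `2π / l`, only `k = 1` can be primitive; and `2π / l` is a proper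
multiple of another time exactly when a proper multiple of `l` lies in `S`. -/
theorem primitiveElements_resonanceTimes {S : Set ℝ} (hS : ∀ l ∈ S, 0 < l) :
    primitiveElements (resonanceTimes S) =
      (fun l ↦ 2 * Real.pi / l) '' {l | l ∈ S ∧ ∀ m : ℕ, 2 ≤ m → (m * l : ℝ) ∉ S} := by
  have hpi := Real.pi_pos
  ext t
  constructor
  · rintro ⟨⟨l, hl, k, hk, rfl⟩, hprim⟩
    have hl0 := hS l hl
    have hk1 : k = 1 := by
      by_contra hne
      refine hprim ⟨k, 2 * Real.pi / l, by omega, ⟨l, hl, 1, le_rfl, by simp⟩, ?_⟩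
      push_cast
      field_simp
    subst hk1
    refine ⟨l, ⟨hl, fun m hm hml ↦ hprim ⟨m, 2 * Real.pi / (m * l), by omega,
      ⟨m * l, hml, 1, le_rfl, by simp⟩, ?_⟩⟩, by simp⟩
    have : (0 : ℝ) < m := by exact_mod_cast (by omega : 0 < m)
    push_cast
    field_simp
  · rintro ⟨l, ⟨hl, hprim⟩, rfl⟩
    have hl0 := hS l hl
    refine ⟨⟨l, hl, 1, le_rfl, by simp⟩, ?_⟩
    rintro ⟨m, t₀, hm, ⟨l', hl', k, hk, rfl⟩, h⟩
    have hl0' := hS l' hl'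
    lift m to ℕ using by omega
    have hm' : 2 ≤ m := by exact_mod_cast hm
    -- The equation `2π / l = m · 2πk / l'` says `l' = (mk) l`.
    refine hprim (m * k) (by nlinarith) ?_
    convert hl' using 1
    push_cast at h ⊢
    field_simp at h
    linarith

/-- The positive numbers `l` such that `l * I` belongs to the multiset. -/
def positiveFrequencies (M : Multiset ℂ) : Set ℝ :=
  {l | 0 < l ∧ (l : ℂ) * Complex.I ∈ M}

variable {M : Multiset ℂ}

theorem eq_im_mul_I {μ : ℂ} (h : μ.re = 0) : (μ.im : ℂ) * Complex.I = μ := by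
  apply Complex.ext <;> simp [h]

theorem positiveFrequencies_eq_image (hre : ∀ μ ∈ M, μ.re = 0) :
    positiveFrequencies M =
      ((M.toFinset.filter fun μ ↦ 0 < μ.im).image Complex.im : Finset ℝ) := by
  ext l
  simp only [positiveFrequencies, Set.mem_ofPred_eq, Finset.coe_image, Finset.coe_filter,
    Multiset.mem_toFinset, Set.mem_image]
  constructor
  · rintro ⟨h0, h⟩
    exact ⟨_, ⟨h, by simpa using h0⟩, by simp⟩
  · rintro ⟨μ, ⟨h, h0⟩, rfl⟩
    exact ⟨h0, by rwa [eq_im_mul_I (hre μ h)]⟩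

/-- Negation matches the elements above the real axis with those below it; on the imaginary axis
only `0` remains. -/
theorem card_toFinset_eq (hre : ∀ μ ∈ M, μ.re = 0) (hneg : ∀ μ ∈ M, -μ ∈ M) :
    M.toFinset.card = 2 * (positiveFrequencies M).ncard + if (0 : ℂ) ∈ M then 1 else 0 := by
  classical
  have hpos : (positiveFrequencies M).ncard = (M.toFinset.filter fun μ ↦ 0 < μ.im).card := by
    rw [positiveFrequencies_eq_image hre, Set.ncard_coe_finset, Finset.card_image_of_injOn]
    intro μ hμ ν hν h
    simp only [Finset.coe_filter, Multiset.mem_toFinset, Set.mem_ofPred_eq] at hμ hν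
    rw [← eq_im_mul_I (hre μ hμ.1), ← eq_im_mul_I (hre ν hν.1), h]
  have hnegc : (M.toFinset.filter fun μ ↦ μ.im < 0).card =
      (M.toFinset.filter fun μ ↦ 0 < μ.im).card := by
    refine Finset.card_nbij' (fun μ ↦ -μ) (fun μ ↦ -μ) ?_ ?_ ?_ ?_
    · intro μ hμ
      simpa using ⟨hneg _ (by simpa using (Finset.mem_filter.1 hμ).1), (Finset.mem_filter.1 hμ).2⟩
    · intro μ hμ
      simpa using ⟨hneg _ (by simpa using (Finset.mem_filter.1 hμ).1), (Finset.mem_filter.1 hμ).2⟩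
    · intro μ _; simp
    · intro μ _; simp
  have hzero : (M.toFinset.filter fun μ ↦ μ.im = 0).card = if (0 : ℂ) ∈ M then 1 else 0 := by
    have : (M.toFinset.filter fun μ ↦ μ.im = 0) = if (0 : ℂ) ∈ M then {0} else ∅ := by
      ext μ
      have : μ ∈ M → (μ.im = 0 ↔ μ = 0) := fun h ↦
        ⟨fun h' ↦ Complex.ext (hre μ h) h', fun h' ↦ by simp [h']⟩
      split_ifs with h0 <;> simp only [Finset.mem_filter, Multiset.mem_toFinset,
        Finset.mem_singleton, Finset.notMem_empty] <;> grind
    rw [this]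
    split_ifs <;> simp
  have h1 := Finset.card_filter_add_card_filter_not (s := M.toFinset) (fun μ ↦ 0 < μ.im)
  have h2 := Finset.card_filter_add_card_filter_not
    (s := M.toFinset.filter fun μ ↦ ¬ 0 < μ.im) (fun μ ↦ μ.im < 0)
  rw [Finset.filter_filter, Finset.filter_filter] at h2
  have e1 : (M.toFinset.filter fun μ ↦ ¬ 0 < μ.im ∧ μ.im < 0) =
      M.toFinset.filter fun μ ↦ μ.im < 0 :=
    Finset.filter_congr fun μ _ ↦ ⟨fun h ↦ h.2, fun h ↦ ⟨h.not_gt, h⟩⟩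
  have e2 : (M.toFinset.filter fun μ ↦ ¬ 0 < μ.im ∧ ¬ μ.im < 0) =
      M.toFinset.filter fun μ ↦ μ.im = 0 :=
    Finset.filter_congr fun μ _ ↦ ⟨fun h ↦ le_antisymm (not_lt.1 h.1) (not_lt.1 h.2),
      fun h ↦ by simp [h]⟩
  rw [e1, e2] at h2
  omega

/-- The frequencies in `S` of which no proper integral multiple is in `S`. -/
def nonresonantFrequencies (S : Set ℝ) : Set ℝ :=
  {l | l ∈ S ∧ ∀ m : ℕ, 2 ≤ m → (m * l : ℝ) ∉ S}

theorem encard_primitiveElements_resonanceTimes {S : Set ℝ} (hS : ∀ l ∈ S, 0 < l) :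
    (primitiveElements (resonanceTimes S)).encard = (nonresonantFrequencies S).encard := by
  rw [primitiveElements_resonanceTimes hS]
  refine Set.InjOn.encard_image fun a ha b hb h ↦ ?_
  have ha0 := hS a ha.1
  have hb0 := hS b hb.1
  have hpi := Real.pi_pos
  field_simp at h
  exact h.symm

/-- The properties of the spectrum, with multiplicities, of a real skew symmetric matrix of
size `q`. -/
structure IsSkewSpectrum (M : Multiset ℂ) (q : ℕ) : Prop where
  card : M.card = q
  re : ∀ μ ∈ M, μ.re = 0
  neg : ∀ μ ∈ M, -μ ∈ M
  zero_of_odd : Odd q → (0 : ℂ) ∈ M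

/-! ### Counting frequencies against the size of the spectrum -/

namespace IsSkewSpectrum

variable {q : ℕ} (h : IsSkewSpectrum M q)

include h

theorem finite_positiveFrequencies : (positiveFrequencies M).Finite := by
  rw [positiveFrequencies_eq_image h.re]
  exact Finset.finite_toSet _

theorem ncard_add_le : 2 * (positiveFrequencies M).ncard + (if (0 : ℂ) ∈ M then 1 else 0) ≤ q := by
  rw [← card_toFinset_eq h.re h.neg, ← h.card]
  exact Multiset.toFinset_card_le M

/-- Simplicity means that twice the number of frequencies, plus one if `0` occurs, equals `q`. The
forced zero for odd `q` makes the parities agree with the floor in `q / 2`. -/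
theorem nodup_iff : M.Nodup ↔ (positiveFrequencies M).ncard = q / 2 := by
  rw [← Multiset.toFinset_card_eq_card_iff_nodup, card_toFinset_eq h.re h.neg, h.card]
  have h1 := h.ncard_add_le
  have h2 := h.zero_of_odd
  rw [Nat.odd_iff] at h2
  split_ifs with h0
  · simp only [h0, if_true] at h1
    omega
  · simp only [h0, if_false] at h1
    have : ¬ q % 2 = 1 := fun h' ↦ h0 (h2 h')
    omega

theorem zero_mem_iff (hM : M.Nodup) : (0 : ℂ) ∈ M ↔ Odd q := by
  refine ⟨fun h0 ↦ ?_, h.zero_of_odd⟩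
  have h1 := h.ncard_add_le
  rw [h.nodup_iff.1 hM, if_pos h0] at h1
  rw [Nat.odd_iff]
  omega

theorem encard_nonresonant_le :
    (nonresonantFrequencies (positiveFrequencies M)).encard ≤ ((q / 2 : ℕ) : ℕ∞) := by
  refine (Set.encard_le_encard fun l hl ↦ hl.1).trans ?_
  rw [← h.finite_positiveFrequencies.cast_ncard_eq]
  have := h.ncard_add_le
  exact_mod_cast (by omega)

/-- The nonresonant frequencies lie among all frequencies, of which there are at most `q / 2`, so
equality at the ends forces it at both inclusions. -/
theorem encard_nonresonant_eq_iff :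
    (nonresonantFrequencies (positiveFrequencies M)).encard = ((q / 2 : ℕ) : ℕ∞) ↔
      M.Nodup ∧ nonresonantFrequencies (positiveFrequencies M) = positiveFrequencies M := by
  have hsub : nonresonantFrequencies (positiveFrequencies M) ⊆ positiveFrequencies M :=
    fun l hl ↦ hl.1
  have hle := h.ncard_add_le
  rw [h.nodup_iff]
  constructor
  · intro he
    have heq : nonresonantFrequencies (positiveFrequencies M) = positiveFrequencies M := by
      refine h.finite_positiveFrequencies.eq_of_subset_of_encard_le' hsub ?_
      rw [he, ← h.finite_positiveFrequencies.cast_ncard_eq]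
      exact_mod_cast (by omega)
    refine ⟨?_, heq⟩
    rw [heq, ← h.finite_positiveFrequencies.cast_ncard_eq] at he
    exact_mod_cast he
  · rintro ⟨h1, h2⟩
    rw [h2, ← h.finite_positiveFrequencies.cast_ncard_eq, h1]

theorem abs_im_mem {μ : ℂ} (hμ : μ ∈ M) (h0 : μ ≠ 0) : |μ.im| ∈ positiveFrequencies M := by
  have him : μ.im ≠ 0 := fun h' ↦ h0 (Complex.ext (h.re μ hμ) h')
  refine ⟨abs_pos.2 him, ?_⟩
  rcases abs_choice μ.im with h' | h' <;> rw [h']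
  · rwa [eq_im_mul_I (h.re μ hμ)]
  · have := h.neg μ hμ
    rw [← eq_im_mul_I (h.re μ hμ)] at this
    simpa using this

/-- Passing to `|im|` turns a ratio `m` of eigenvalues into a ratio `|m|` of frequencies, which is
why both signs of `m` are excluded. -/
theorem nonresonant_eq_iff :
    nonresonantFrequencies (positiveFrequencies M) = positiveFrequencies M ↔
      ∀ μ ∈ M, ∀ ν ∈ M, μ ≠ ν → μ ≠ 0 → ν ≠ 0 → ∀ m : ℤ, 2 ≤ |m| → μ / ν ≠ (m : ℂ) := by
  constructor
  · intro heq μ hμ ν hν _ hμ0 hν0 m hm hdiv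
    have h1 := h.abs_im_mem hμ hμ0
    have h2 := h.abs_im_mem hν hν0
    rw [← heq] at h2
    refine h2.2 m.natAbs (by rw [Int.abs_eq_natAbs] at hm; omega) ?_
    convert h1 using 1
    rw [div_eq_iff hν0] at hdiv
    rw [hdiv, Nat.cast_natAbs]
    simp [abs_mul]
  · intro hdiv
    refine Set.Subset.antisymm (fun l hl ↦ hl.1) fun l hl ↦ ⟨hl, fun m hm hml ↦ ?_⟩
    have hl0 : (l : ℂ) ≠ 0 := by exact_mod_cast hl.1.ne'
    have hm0 : (m : ℂ) ≠ 0 := by exact_mod_cast (by omega : m ≠ 0)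
    refine hdiv _ hml.2 _ hl.2 ?_ ?_ ?_ m (by rw [abs_of_nonneg] <;> omega) ?_
    · intro he
      have := congrArg Complex.im he
      simp only [Complex.ofReal_mul, Complex.ofReal_natCast, Complex.mul_im, Complex.mul_re,
        Complex.natCast_re, Complex.natCast_im, Complex.ofReal_re, Complex.ofReal_im, Complex.I_re,
        Complex.I_im] at this
      have hm2 : (2 : ℝ) ≤ m := by exact_mod_cast hm
      nlinarith [hl.1]
    · push_cast; simp [hl0, hm0]
    · simp [hl0]
    · push_cast
      field_simp

theorem nonzero_eq : {μ : ℂ | μ ∈ M ∧ μ ≠ 0} = {μ : ℂ | ∃ l ∈ positiveFrequencies M,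
    μ = (l : ℂ) * Complex.I ∨ μ = -((l : ℂ) * Complex.I)} := by
  ext μ
  constructor
  · rintro ⟨hμ, h0⟩
    refine ⟨_, h.abs_im_mem hμ h0, ?_⟩
    rcases abs_choice μ.im with h' | h' <;> rw [h']
    · exact Or.inl (eq_im_mul_I (h.re μ hμ)).symm
    · right
      simp [eq_im_mul_I (h.re μ hμ)]
  · rintro ⟨l, hl, rfl | rfl⟩
    · exact ⟨hl.2, by simp [hl.1.ne']⟩
    · exact ⟨h.neg _ hl.2, by simp [hl.1.ne']⟩

theorem primitiveElements_conclusion {T : Set ℝ}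
    (hT : T = primitiveElements (resonanceTimes (positiveFrequencies M))) :
    T.encard ≤ ((q / 2 : ℕ) : ℕ∞) ∧
    (T.encard = ((q / 2 : ℕ) : ℕ∞) ↔
      M.Nodup ∧ ∀ μ ∈ M, ∀ ν ∈ M, μ ≠ ν → μ ≠ 0 → ν ≠ 0 →
        ∀ m : ℤ, 2 ≤ |m| → μ / ν ≠ (m : ℂ)) ∧
    (∀ t : Fin (q / 2) → ℝ, Function.Injective t → (∀ k, t k ∈ T) →
      ∃ lam : Fin (q / 2) → ℝ,
        (∀ k, 0 < lam k ∧ t k = 2 * Real.pi / lam k ∧ (lam k : ℂ) * Complex.I ∈ M) ∧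
        {μ : ℂ | μ ∈ M ∧ μ ≠ 0} =
          {μ : ℂ | ∃ k, μ = (lam k : ℂ) * Complex.I ∨ μ = -((lam k : ℂ) * Complex.I)}) ∧
    (T.encard = ((q / 2 : ℕ) : ℕ∞) →
      M.Nodup ∧ (0 ∈ M ↔ Odd q) ∧
      {μ : ℂ | μ ∈ M ∧ μ ≠ 0} =
        {μ : ℂ | ∃ t ∈ T,
          μ = ((2 * Real.pi / t : ℝ) : ℂ) * Complex.I ∨
            μ = -(((2 * Real.pi / t : ℝ) : ℂ) * Complex.I)}) := by
  have hpos : ∀ l ∈ positiveFrequencies M, 0 < l := fun l hl ↦ hl.1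
  have hinv : ∀ l : ℝ, 2 * Real.pi / (2 * Real.pi / l) = l := fun l ↦ by
    have := Real.pi_pos
    rw [div_div_cancel₀ (by positivity)]
  have hcard := encard_primitiveElements_resonanceTimes hpos
  rw [← hT] at hcard
  have hTim : T = (fun l ↦ 2 * Real.pi / l) '' nonresonantFrequencies (positiveFrequencies M) :=
    hT.trans (primitiveElements_resonanceTimes hpos)
  have hle : T.encard ≤ ((q / 2 : ℕ) : ℕ∞) := hcard ▸ h.encard_nonresonant_le
  have hset : T.encard = ((q / 2 : ℕ) : ℕ∞) → {μ : ℂ | μ ∈ M ∧ μ ≠ 0} =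
      {μ : ℂ | ∃ t ∈ T, μ = ((2 * Real.pi / t : ℝ) : ℂ) * Complex.I ∨
            μ = -(((2 * Real.pi / t : ℝ) : ℂ) * Complex.I)} := by
    intro he
    rw [hcard, h.encard_nonresonant_eq_iff] at he
    rw [h.nonzero_eq, hTim, he.2]
    ext μ
    simp only [Set.mem_ofPred_eq, Set.exists_mem_image, hinv]
  refine ⟨hle, ?_, ?_, ?_⟩
  · rw [hcard, h.encard_nonresonant_eq_iff, h.nonresonant_eq_iff]
  · intro t ht htT
    have hrange : Set.range t ⊆ T := Set.range_subset_iff.2 htT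
    have hfin : T.Finite := Set.finite_of_encard_le_coe hle
    have hcr : (Set.range t).encard = ((q / 2 : ℕ) : ℕ∞) := by
      rw [← Set.image_univ, ht.encard_image, Set.encard_univ]
      simp
    -- As `T` has at most `q / 2` elements, `q / 2` distinct ones exhaust it.
    have hTr : Set.range t = T :=
      hfin.eq_of_subset_of_encard_le' hrange (by rw [hcr]; exact hle)
    refine ⟨fun k ↦ 2 * Real.pi / t k, fun k ↦ ?_, ?_⟩
    · have := htT k
      rw [hTim] at this
      obtain ⟨l, hl, hlt⟩ := this
      simp only at hlt ⊢
      rw [← hlt, hinv]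
      exact ⟨hl.1.1, rfl, hl.1.2⟩
    · rw [hset (by rw [← hTr, hcr]), ← hTr]
      ext μ
      simp only [Set.mem_ofPred_eq, Set.exists_range_iff]
  · intro he
    have h2 := he
    rw [hcard, h.encard_nonresonant_eq_iff] at h2
    exact ⟨h2.1, h.zero_mem_iff h2.1, hset he⟩

end IsSkewSpectrum

end Combinatorics

/-! ### Complex eigenvalues of real endomorphisms -/

section ComplexEigenvalues

variable {V : Type*} [AddCommGroup V] [Module ℝ V]

/-- The real and imaginary parts `x`, `y` of a complex eigenvector of `f` for the eigenvalue `μ`. -/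
def IsEigenpair (f : Module.End ℝ V) (μ : ℂ) (x y : V) : Prop :=
  (x ≠ 0 ∨ y ≠ 0) ∧ f x = μ.re • x - μ.im • y ∧ f y = μ.im • x + μ.re • y

variable [FiniteDimensional ℝ V]

/-- A root makes `μ - A` singular over `ℂ`, where `A` is a real matrix of `f`; the real and
imaginary parts of a kernel vector form the pair. This avoids complexifying `V`. -/
theorem isRoot_charpoly_map_iff (f : Module.End ℝ V) (μ : ℂ) :
    (f.charpoly.map (algebraMap ℝ ℂ)).IsRoot μ ↔ ∃ x y, IsEigenpair f μ x y := by
  classical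
  let b := Module.finBasis ℝ V
  set A := LinearMap.toMatrix b b f with hA
  have hAf : ∀ w, A.mulVec w = b.equivFun (f (b.equivFun.symm w)) := fun w ↦ by
    have := LinearMap.toMatrix_mulVec_repr b b f (b.equivFun.symm w)
    rw [← hA] at this
    rw [Module.Basis.equivFun_apply, ← this, ← Module.Basis.equivFun_apply,
      LinearEquiv.apply_symm_apply]
  rw [← LinearMap.charpoly_toMatrix f b, ← Matrix.charpoly_map, Polynomial.IsRoot.def,
    Matrix.eval_charpoly, ← Matrix.exists_mulVec_eq_zero_iff]
  have key : ∀ v : Fin (Module.finrank ℝ V) → ℂ,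
      ((Matrix.scalar _) μ - A.map (algebraMap ℝ ℂ)).mulVec v = 0 ↔
        A.mulVec (fun i ↦ (v i).re) = μ.re • (fun i ↦ (v i).re) - μ.im • (fun i ↦ (v i).im) ∧
        A.mulVec (fun i ↦ (v i).im) = μ.im • (fun i ↦ (v i).re) + μ.re • (fun i ↦ (v i).im) := by
    intro v
    rw [Matrix.sub_mulVec, sub_eq_zero, funext_iff, funext_iff, funext_iff, ← forall_and]
    refine forall_congr' fun i ↦ ?_
    rw [Matrix.scalar_apply, Matrix.mulVec_diagonal, Complex.ext_iff]
    simp only [Complex.mul_re, Complex.mul_im,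
      Matrix.mulVec, dotProduct, Complex.re_sum, Complex.im_sum, Matrix.map_apply,
      Complex.coe_algebraMap, Complex.ofReal_re, Complex.ofReal_im, zero_mul, sub_zero, add_zero,
      Pi.add_apply, Pi.sub_apply, Pi.smul_apply, smul_eq_mul]
    constructor <;> rintro ⟨h1, h2⟩ <;> constructor <;> linarith
  constructor
  · rintro ⟨v, hv, h⟩
    rw [key] at h
    refine ⟨b.equivFun.symm fun i ↦ (v i).re, b.equivFun.symm fun i ↦ (v i).im, ?_, ?_, ?_⟩
    · by_contra! h0
      simp only [LinearEquiv.map_eq_zero_iff] at h0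
      exact hv (funext fun i ↦ Complex.ext (congrFun h0.1 i) (congrFun h0.2 i))
    · rw [← map_smul, ← map_smul, ← map_sub, ← h.1, hAf, LinearEquiv.symm_apply_apply]
    · rw [← map_smul, ← map_smul, ← map_add, ← h.2, hAf, LinearEquiv.symm_apply_apply]
  · rintro ⟨x, y, h0, hx, hy⟩
    refine ⟨fun i ↦ ⟨b.equivFun x i, b.equivFun y i⟩, ?_, ?_⟩
    · intro h
      simp only [funext_iff, Complex.ext_iff, forall_and] at h
      rcases h0 with h0 | h0 <;> refine h0 (b.equivFun.map_eq_zero_iff.1 (funext fun i ↦ ?_))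
      exacts [h.1 i, h.2 i]
    · rw [key]
      change A.mulVec (b.equivFun x) = μ.re • b.equivFun x - μ.im • b.equivFun y ∧
        A.mulVec (b.equivFun y) = μ.im • b.equivFun x + μ.re • b.equivFun y
      rw [hAf, hAf, LinearEquiv.symm_apply_apply, LinearEquiv.symm_apply_apply, hx, hy]
      simp only [map_add, map_sub, map_smul, and_self]

theorem mem_roots_charpoly_map_iff (f : Module.End ℝ V) (μ : ℂ) :
    μ ∈ (f.charpoly.map (algebraMap ℝ ℂ)).roots ↔ ∃ x y, IsEigenpair f μ x y := by
  rw [Polynomial.mem_roots ((f.charpoly_monic.map _).ne_zero), isRoot_charpoly_map_iff]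

theorem card_roots_charpoly_map (f : Module.End ℝ V) :
    (f.charpoly.map (algebraMap ℝ ℂ)).roots.card = Module.finrank ℝ V := by
  rw [IsAlgClosed.card_roots_eq_natDegree, Polynomial.natDegree_map, LinearMap.charpoly_natDegree]

theorem exists_isEigenpair [Nontrivial V] (f : Module.End ℝ V) :
    ∃ μ x y, IsEigenpair f μ x y := by
  have h : 0 < (f.charpoly.map (algebraMap ℝ ℂ)).roots.card := by
    rw [card_roots_charpoly_map]
    exact Module.finrank_pos
  obtain ⟨μ, hμ⟩ := Multiset.card_pos_iff_exists_mem.1 h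
  exact ⟨μ, (mem_roots_charpoly_map_iff f μ).1 hμ⟩

end ComplexEigenvalues

/-! ### Skew symmetric endomorphisms -/

section Skew

variable {V : Type*} [AddCommGroup V] [Module ℝ V]

/-- `f` is skew symmetric with respect to the positive definite form `B`. -/
structure IsSkewFor (B : LinearMap.BilinForm ℝ V) (f : Module.End ℝ V) : Prop where
  symm : ∀ x y, B x y = B y x
  pos : ∀ x, x ≠ 0 → 0 < B x x
  skew : ∀ x y, B (f x) y = -B x (f y)

namespace IsSkewFor

variable {B : LinearMap.BilinForm ℝ V} {f : Module.End ℝ V} (h : IsSkewFor B f)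

include h

theorem nonneg (x : V) : 0 ≤ B x x := by
  by_cases hx : x = 0
  · simp [hx]
  · exact (h.pos x hx).le

theorem apply_self_eq_zero (x : V) : B (f x) x = 0 := by
  have := h.skew x x
  rw [h.symm x] at this
  linarith

/-- Adding `B (f x) x = 0` and `B (f y) y = 0` cancels the mixed terms and leaves `μ.re * (B x x + B
y y) = 0`. -/
theorem re_eq_zero {μ : ℂ} {x y : V} (hxy : IsEigenpair f μ x y) : μ.re = 0 := by
  obtain ⟨h0, hx, hy⟩ := hxy
  have h1 := h.apply_self_eq_zero x
  have h2 := h.apply_self_eq_zero y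
  rw [hx] at h1
  rw [hy] at h2
  simp only [map_sub, map_add, map_smul, LinearMap.sub_apply, LinearMap.add_apply,
    LinearMap.smul_apply, smul_eq_mul] at h1 h2
  rw [h.symm y x] at h1
  have h3 : μ.re * (B x x + B y y) = 0 := by linarith
  refine (mul_eq_zero.1 h3).resolve_right (ne_of_gt ?_)
  rcases h0 with h0 | h0
  · linarith [h.pos x h0, h.nonneg y]
  · linarith [h.pos y h0, h.nonneg x]

/-- A complex eigenvector gives a real eigenvector of the square. -/
theorem exists_sq_eigenvector {μ : ℂ} {x y : V} (hxy : IsEigenpair f μ x y) :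
    ∃ e : V, (e = x ∨ e = y) ∧ e ≠ 0 ∧ f (f e) = -(μ.im ^ 2) • e := by
  have hre := h.re_eq_zero hxy
  obtain ⟨h0, hx, hy⟩ := hxy
  simp only [hre, zero_smul, zero_sub, add_zero] at hx hy
  rcases h0 with h0 | h0
  · refine ⟨x, Or.inl rfl, h0, ?_⟩
    rw [hx, map_neg, map_smul, hy, smul_smul, neg_smul, sq]
  · refine ⟨y, Or.inr rfl, h0, ?_⟩
    rw [hy, map_smul, hx, smul_neg, smul_smul, neg_smul, sq]

omit h in
theorem exists_isEigenpair_of_sq {l : ℝ} (hl : l ≠ 0) {e : V} (he : e ≠ 0)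
    (hfe : f (f e) = -(l ^ 2) • e) : ∃ x y, IsEigenpair f ((l : ℂ) * Complex.I) x y := by
  refine ⟨e, -(l⁻¹ • f e), Or.inl he, ?_, ?_⟩
  · simp [smul_smul, hl]
  · simp only [map_neg, map_smul, hfe, smul_smul]
    simp
    field_simp

theorem isEigenpair_neg {μ : ℂ} {x y : V} (hxy : IsEigenpair f μ x y) :
    IsEigenpair f (-μ) x (-y) := by
  have hre := h.re_eq_zero hxy
  obtain ⟨h0, hx, hy⟩ := hxy
  refine ⟨by simpa using h0, ?_, ?_⟩
  · simp [hx, hre]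
  · simp [hy, hre]

theorem mem_eigenvalues_iff [FiniteDimensional ℝ V] {l : ℝ} (hl : 0 < l) :
    (l : ℂ) * Complex.I ∈ (f.charpoly.map (algebraMap ℝ ℂ)).roots ↔
      ∃ e, e ≠ 0 ∧ f (f e) = -(l ^ 2) • e := by
  rw [mem_roots_charpoly_map_iff]
  constructor
  · rintro ⟨x, y, hxy⟩
    obtain ⟨e, -, he, hfe⟩ := h.exists_sq_eigenvector hxy
    exact ⟨e, he, by simpa using hfe⟩
  · rintro ⟨e, he, hfe⟩
    exact exists_isEigenpair_of_sq hl.ne' he hfe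

/-- The Gram-type matrix `B (f bᵢ) bₖ` is antisymmetric of odd size, hence singular. -/
theorem exists_ker_of_odd [FiniteDimensional ℝ V] (hodd : Odd (Module.finrank ℝ V)) :
    ∃ x, x ≠ 0 ∧ f x = 0 := by
  classical
  let b := Module.finBasis ℝ V
  let K : Matrix (Fin (Module.finrank ℝ V)) (Fin (Module.finrank ℝ V)) ℝ :=
    Matrix.of fun i k ↦ B (f (b i)) (b k)
  have hK : K.transpose = -K := by
    ext i k
    simp only [K, Matrix.transpose_apply, Matrix.of_apply, Matrix.neg_apply]
    rw [h.skew, h.symm]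
  have hdet : K.det = 0 := by
    have := congrArg Matrix.det hK
    rw [Matrix.det_transpose, Matrix.det_neg, Fintype.card_fin, hodd.neg_one_pow] at this
    linarith
  obtain ⟨v, hv, hvK⟩ := Matrix.exists_vecMul_eq_zero_iff.2 hdet
  refine ⟨b.equivFun.symm v, mt b.equivFun.symm.map_eq_zero_iff.1 hv, ?_⟩
  have hzero : B (f (b.equivFun.symm v)) = 0 := by
    refine b.ext fun k ↦ ?_
    have := congrFun hvK k
    simp only [Matrix.vecMul, dotProduct, K, Matrix.of_apply, Pi.zero_apply] at this
    rw [Module.Basis.equivFun_symm_apply]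
    simpa using this
  by_contra hne
  exact (h.pos _ hne).ne' (by rw [hzero]; rfl)

theorem isSkewSpectrum [FiniteDimensional ℝ V] :
    IsSkewSpectrum (f.charpoly.map (algebraMap ℝ ℂ)).roots (Module.finrank ℝ V) where
  card := card_roots_charpoly_map f
  re μ hμ := by
    obtain ⟨x, y, hxy⟩ := (mem_roots_charpoly_map_iff f μ).1 hμ
    exact h.re_eq_zero hxy
  neg μ hμ := by
    obtain ⟨x, y, hxy⟩ := (mem_roots_charpoly_map_iff f μ).1 hμ
    exact (mem_roots_charpoly_map_iff f _).2 ⟨x, -y, h.isEigenpair_neg hxy⟩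
  zero_of_odd hodd := by
    obtain ⟨x, hx, hfx⟩ := h.exists_ker_of_odd hodd
    exact (mem_roots_charpoly_map_iff f _).2 ⟨x, 0, Or.inl hx, by simp [hfx], by simp⟩

end IsSkewFor

end Skew

/-! ### The extension of `j(Z)` to the whole Lie algebra -/

section JMap

variable {L : Type*} [LieRing L] [LieAlgebra ℝ L]

theorem commutatorSubspace_eq_span :
    commutatorSubspace L = Submodule.span ℝ {z | ∃ x y : L, ⁅x, y⁆ = z} := by
  rw [commutatorSubspace, LieSubmodule.lieIdeal_oper_eq_linear_span']
  simp

theorem IsTwoStepNilpotent.lie_eq_zero (hL : IsTwoStepNilpotent L) {z : L}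
    (hz : z ∈ commutatorSubspace L) (x : L) : ⁅z, x⁆ = 0 := by
  rw [commutatorSubspace_eq_span] at hz
  induction hz using Submodule.span_induction with
  | mem z hz => obtain ⟨a, b, rfl⟩ := hz; exact hL.1 a b x
  | zero => simp
  | add a b _ _ ha hb => simp [ha, hb]
  | smul c a _ ha => simp [ha]

variable {B : LinearMap.BilinForm ℝ L}

theorem IsInnerProduct.nondegenerate (hB : IsInnerProduct B) : B.Nondegenerate := by
  constructor
  · intro x hx
    by_contra hne
    exact (hB.pos x hne).ne' (hx x)
  · intro x hx
    by_contra hne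
    exact (hB.pos x hne).ne' (hx x)

theorem IsInnerProduct.ext (hB : IsInnerProduct B) {x y : L} (h : ∀ z, B x z = B y z) : x = y := by
  by_contra hne
  refine (hB.pos (x - y) (sub_ne_zero.2 hne)).ne' ?_
  rw [map_sub B, LinearMap.sub_apply, h, sub_self]

variable [FiniteDimensional ℝ L]

/-- The endomorphism `J` of the Lie algebra with `⟨J X, Y⟩ = ⟨[X, Y], Z⟩`. -/
noncomputable def jExtended (hB : IsInnerProduct B) (Z : L) : Module.End ℝ L :=
  (B.toDual hB.nondegenerate).symm.toLinearMap ∘ₗ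
    LinearMap.mk₂ ℝ (fun X Y ↦ B ⁅X, Y⁆ Z)
      (by intros; simp) (by intros; simp) (by intros; simp) (by intros; simp)

theorem jExtended_spec (hB : IsInnerProduct B) (Z X Y : L) :
    B (jExtended hB Z X) Y = B ⁅X, Y⁆ Z := by
  simp [jExtended, LinearMap.BilinForm.apply_toDual_symm_apply]

theorem isSkewFor_jExtended (hB : IsInnerProduct B) (Z : L) : IsSkewFor B (jExtended hB Z) where
  symm := hB.symm
  pos := hB.pos
  skew x y := by
    rw [hB.symm x, jExtended_spec, jExtended_spec, ← lie_skew, map_neg, LinearMap.neg_apply]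

theorem isSkewFor_jMap (hB : IsInnerProduct B) (Z : L) :
    IsSkewFor (B.restrict (horizontalSpace B)) (jMap hB Z) where
  symm x y := hB.symm x y
  pos x hx := hB.pos x (by simpa using hx)
  skew x y := by
    have h1 := jMap_spec hB Z x y
    have h2 := jMap_spec hB Z y x
    rw [hB.symm] at h2
    change B (jMap hB Z x) y = -B x (jMap hB Z y)
    rw [h1, h2, ← lie_skew, map_neg, LinearMap.neg_apply]

omit [FiniteDimensional ℝ L] in
theorem mem_horizontalSpace_iff (hB : IsInnerProduct B) {x : L} :
    x ∈ horizontalSpace B ↔ ∀ z ∈ commutatorSubspace L, B x z = 0 := by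
  rw [horizontalSpace, LinearMap.BilinForm.mem_orthogonal_iff]
  refine forall₂_congr fun z _ ↦ ?_
  rw [hB.symm]

/-- Brackets with the central commutator subspace vanish, so `J X` is orthogonal to it. -/
theorem jExtended_mem (hB : IsInnerProduct B) (hL : IsTwoStepNilpotent L) (Z X : L) :
    jExtended hB Z X ∈ horizontalSpace B := by
  rw [mem_horizontalSpace_iff hB]
  intro z hz
  rw [jExtended_spec, ← lie_skew, hL.lie_eq_zero hz]
  simp

theorem coe_jMap (hB : IsInnerProduct B) (hL : IsTwoStepNilpotent L) (Z : L)
    (X : horizontalSpace B) : (jMap hB Z X : L) = jExtended hB Z X := by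
  have hmem : (jMap hB Z X : L) - jExtended hB Z X ∈ horizontalSpace B :=
    (horizontalSpace B).sub_mem (jMap hB Z X).2 (jExtended_mem hB hL Z X)
  by_contra hne
  refine (hB.pos _ (sub_ne_zero.2 hne)).ne' ?_
  have h1 := jMap_spec hB Z X ⟨_, hmem⟩
  have h2 := jExtended_spec hB Z X ((jMap hB Z X : L) - jExtended hB Z X)
  rw [map_sub B, LinearMap.sub_apply, h2]
  simpa only [sub_eq_zero] using h1

theorem finrank_horizontalSpace (hB : IsInnerProduct B) :
    Module.finrank ℝ (horizontalSpace B) = Module.finrank ℝ (L ⧸ commutatorSubspace L) := by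
  rw [horizontalSpace, LinearMap.BilinForm.finrank_orthogonal hB.nondegenerate,
    Submodule.finrank_quotient]

theorem isSkewSpectrum_jEigenvalues (hB : IsInnerProduct B) (Z : L) :
    IsSkewSpectrum (jEigenvalues hB Z) (Module.finrank ℝ (L ⧸ commutatorSubspace L)) := by
  rw [← finrank_horizontalSpace hB]
  exact (isSkewFor_jMap hB Z).isSkewSpectrum

/-- Extending `j(Z)` to the whole algebra creates no new positive frequency: if `J² e = -l² e` with
`l ≠ 0`, then `e` is in the image of `J`, hence horizontal. -/
theorem positiveFrequencies_jEigenvalues (hB : IsInnerProduct B) (hL : IsTwoStepNilpotent L)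
    (Z : L) : positiveFrequencies (jEigenvalues hB Z) =
      {l | 0 < l ∧ ∃ e, e ≠ 0 ∧ jExtended hB Z (jExtended hB Z e) = -(l ^ 2) • e} := by
  ext l
  refine and_congr_right fun hl ↦ ?_
  rw [jEigenvalues, (isSkewFor_jMap hB Z).mem_eigenvalues_iff hl]
  constructor
  · rintro ⟨e, he, hje⟩
    refine ⟨e, by simpa using he, ?_⟩
    rw [← coe_jMap hB hL, ← coe_jMap hB hL, hje]
    rfl
  · rintro ⟨e, he, hje⟩
    have hmem : e ∈ horizontalSpace B := by
      have h1 := jExtended_mem hB hL Z (jExtended hB Z e)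
      rw [hje] at h1
      exact ((horizontalSpace B).smul_mem_iff (by simp [hl.ne'])).1 h1
    refine ⟨⟨e, hmem⟩, by simpa using he, Subtype.ext ?_⟩
    rw [coe_jMap hB hL, coe_jMap hB hL, hje]
    rfl

end JMap

/-! ### The equation `y'' = J y'` with `J` skew symmetric -/

section ODE

variable {E : Type*} [NormedAddCommGroup E] [NormedSpace ℝ E]

/-- `y` is a smooth solution of `y'' = J y'` with `y 0 = 0`. -/
structure IsTwistSolution (J : Module.End ℝ E) (y : ℝ → E) : Prop where
  contDiff : ContDiff ℝ ∞ y
  eqn : ∀ s, deriv (deriv y) s = J (deriv y s)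
  init : y 0 = 0

namespace IsTwistSolution

variable {J : Module.End ℝ E} {y z : ℝ → E}

theorem differentiable (hy : IsTwistSolution J y) : Differentiable ℝ y :=
  hy.contDiff.differentiable (by simp)

theorem contDiff_deriv (hy : IsTwistSolution J y) : ContDiff ℝ ∞ (deriv y) :=
  (contDiff_infty_iff_deriv.1 hy.contDiff).2

theorem differentiable_deriv (hy : IsTwistSolution J y) : Differentiable ℝ (deriv y) :=
  hy.contDiff_deriv.differentiable (by simp)

theorem deriv_add_eq (hy : IsTwistSolution J y) (hz : IsTwistSolution J z) :
    deriv (y + z) = deriv y + deriv z :=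
  funext fun s ↦ deriv_add (hy.differentiable s) (hz.differentiable s)

theorem deriv_smul_eq (c : ℝ) (hy : IsTwistSolution J y) : deriv (c • y) = c • deriv y :=
  funext fun s ↦ deriv_const_smul c (hy.differentiable s)

theorem zero : IsTwistSolution J 0 where
  contDiff := contDiff_const
  eqn s := by
    have : deriv (0 : ℝ → E) = 0 := by ext; simp
    simp [this]
  init := rfl

theorem add (hy : IsTwistSolution J y) (hz : IsTwistSolution J z) : IsTwistSolution J (y + z) where
  contDiff := hy.contDiff.add hz.contDiff
  eqn s := by
    rw [deriv_add_eq hy hz, deriv_add (hy.differentiable_deriv s) (hz.differentiable_deriv s),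
      hy.eqn, hz.eqn, Pi.add_apply, map_add]
  init := by simp [hy.init, hz.init]

theorem smul (c : ℝ) (hy : IsTwistSolution J y) : IsTwistSolution J (c • y) where
  contDiff := hy.contDiff.const_smul c
  eqn s := by
    rw [deriv_smul_eq c hy, deriv_const_smul c (hy.differentiable_deriv s), hy.eqn, Pi.smul_apply,
      map_smul]
  init := by simp [hy.init]

variable [FiniteDimensional ℝ E]

theorem deriv_comp_eq {y : ℝ → E} (hy : Differentiable ℝ y) :
    deriv (fun s ↦ J (y s)) = fun s ↦ J (deriv y s) :=
  funext fun s ↦ ((LinearMap.toContinuousLinearMap J).hasFDerivAt.comp_hasDerivAt s (hy s).hasDerivAt).deriv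

/-- `J` commutes with the equation; this makes `vanishingVelocities` invariant under `J`. -/
theorem map (hy : IsTwistSolution J y) : IsTwistSolution J (fun s ↦ J (y s)) where
  contDiff := (LinearMap.toContinuousLinearMap J).contDiff.comp hy.contDiff
  eqn s := by
    rw [deriv_comp_eq hy.differentiable, deriv_comp_eq hy.differentiable_deriv]
    simp only [hy.eqn]
  init := by simp [hy.init]

/-- The velocity solves the linear first order equation `v' = J v`, so uniqueness makes it zero and
`y` constant. -/
theorem eq_zero (hy : IsTwistSolution J y) (h0 : deriv y 0 = 0) : y = 0 := by
  have hlip := (LinearMap.toContinuousLinearMap J).lipschitz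
  have hd : deriv y = 0 := by
    refine ODE_solution_unique_univ (v := fun _ x ↦ J x) (s := fun _ ↦ Set.univ) (t₀ := 0)
      (fun t ↦ hlip.lipschitzOnWith) (fun t ↦ ⟨?_, trivial⟩) (fun t ↦ ⟨?_, trivial⟩) h0
    · rw [← hy.eqn]
      exact (hy.differentiable_deriv t).hasDerivAt
    · simp
  ext s
  rw [is_const_of_deriv_eq_zero hy.differentiable (fun x ↦ congrFun hd x) s 0, hy.init]
  rfl

theorem eq_of_deriv_eq (hy : IsTwistSolution J y) (hz : IsTwistSolution J z)
    (h0 : deriv y 0 = deriv z 0) : y = z := by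
  have h := (hy.add (hz.smul (-1))).eq_zero (by
    rw [deriv_add_eq hy (hz.smul (-1)), deriv_smul_eq _ hz]
    simp [h0])
  ext s
  simpa [← sub_eq_add_neg, sub_eq_zero] using congrFun h s

end IsTwistSolution

/-- The initial velocities of the solutions that vanish at time `t`. -/
def vanishingVelocities (J : Module.End ℝ E) (t : ℝ) : Submodule ℝ E where
  carrier := {c | ∃ y, IsTwistSolution J y ∧ y t = 0 ∧ deriv y 0 = c}
  zero_mem' := ⟨0, .zero, rfl, by
    have : deriv (0 : ℝ → E) = 0 := by ext; simp
    simp [this]⟩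
  add_mem' := by
    rintro _ _ ⟨y, hy, hyt, rfl⟩ ⟨z, hz, hzt, rfl⟩
    exact ⟨y + z, hy.add hz, by simp [hyt, hzt], by rw [IsTwistSolution.deriv_add_eq hy hz]; rfl⟩
  smul_mem' := by
    rintro c _ ⟨y, hy, hyt, rfl⟩
    exact ⟨c • y, hy.smul c, by simp [hyt], by rw [IsTwistSolution.deriv_smul_eq c hy]; rfl⟩

/-- The solution of `y'' = J y'`, `y 0 = 0`, `y' 0 = e` when `J² e = -l² e`. -/
noncomputable def rotatingSolution (J : Module.End ℝ E) (l : ℝ) (e : E) (s : ℝ) : E :=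
  (Real.sin (l * s) / l) • e + ((1 - Real.cos (l * s)) / l ^ 2) • J e

variable {J : Module.End ℝ E}

theorem deriv_rotatingSolution {l : ℝ} (hl : l ≠ 0) (e : E) :
    deriv (rotatingSolution J l e) =
      fun s ↦ Real.cos (l * s) • e + (Real.sin (l * s) / l) • J e := by
  ext s
  have hlin : HasDerivAt (fun s ↦ l * s) l s := by simpa using (hasDerivAt_id s).const_mul l
  have h1 : HasDerivAt (fun s ↦ Real.sin (l * s) / l) (Real.cos (l * s)) s :=
    (hlin.sin.div_const l).congr_deriv (by field_simp)
  have h2 : HasDerivAt (fun s ↦ (1 - Real.cos (l * s)) / l ^ 2) (Real.sin (l * s) / l) s :=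
    ((hlin.cos.const_sub 1).div_const (l ^ 2)).congr_deriv (by field_simp)
  exact ((h1.smul_const e).add (h2.smul_const (J e))).deriv

theorem isTwistSolution_rotatingSolution {l : ℝ} (hl : l ≠ 0) {e : E}
    (he : J (J e) = -(l ^ 2) • e) : IsTwistSolution J (rotatingSolution J l e) where
  contDiff := by
    unfold rotatingSolution
    fun_prop
  eqn s := by
    rw [deriv_rotatingSolution hl]
    have hlin : HasDerivAt (fun s ↦ l * s) l s := by simpa using (hasDerivAt_id s).const_mul l
    have h1 : HasDerivAt (fun s ↦ Real.sin (l * s) / l) (Real.cos (l * s)) s :=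
      (hlin.sin.div_const l).congr_deriv (by field_simp)
    refine ((hlin.cos.smul_const e).add (h1.smul_const (J e))).deriv.trans ?_
    simp only [map_add, map_smul, he, smul_smul]
    rw [add_comm]
    congr 2
    field_simp
  init := by simp [rotatingSolution]

theorem IsSkewFor.apply_map_self {B : LinearMap.BilinForm ℝ E} (h : IsSkewFor B J) {l : ℝ} {e : E}
    (he : J (J e) = -(l ^ 2) • e) : B (J e) (J e) = l ^ 2 * B e e := by
  rw [h.skew, he]
  simp

variable [FiniteDimensional ℝ E]

/-- An arbitrary vanishing solution may mix frequencies. Restricting the skew map `J` to the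
invariant space of vanishing velocities yields one of a single frequency, known explicitly by
uniqueness. -/
theorem IsSkewFor.exists_vanishing_iff {B : LinearMap.BilinForm ℝ E} (h : IsSkewFor B J) {t : ℝ}
    (ht : 0 < t) :
    (∃ y, IsTwistSolution J y ∧ (∃ s, y s ≠ 0) ∧ y t = 0) ↔
      t ∈ resonanceTimes {l | 0 < l ∧ ∃ e, e ≠ 0 ∧ J (J e) = -(l ^ 2) • e} := by
  have hpi := Real.pi_pos
  constructor
  · rintro ⟨y, hy, ⟨s, hs⟩, hyt⟩
    have hne : deriv y 0 ≠ 0 := fun h0 ↦ hs (congrFun (hy.eq_zero h0) s)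
    let K := vanishingVelocities J t
    have hK : ∀ c ∈ K, J c ∈ K := by
      rintro _ ⟨z, hz, hzt, rfl⟩
      exact ⟨_, hz.map, by simp [hzt], by rw [IsTwistSolution.deriv_comp_eq hz.differentiable]⟩
    have : Nontrivial K :=
      ⟨⟨⟨_, y, hy, hyt, rfl⟩, 0, fun h' ↦ hne (congrArg Subtype.val h')⟩⟩
    have hKs : IsSkewFor (B.restrict K) (J.restrict hK) :=
      ⟨fun a b ↦ h.symm a b, fun a ha ↦ h.pos a (by simpa using ha), fun a b ↦ h.skew a b⟩
    obtain ⟨μ, a, b, hab⟩ := exists_isEigenpair (J.restrict hK)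
    obtain ⟨⟨e, z, hz, hzt, hze⟩, -, he0, he⟩ := hKs.exists_sq_eigenvector hab
    have he0 : e ≠ 0 := fun h' ↦ he0 (Subtype.ext h')
    have he : J (J e) = -(μ.im ^ 2) • e := congrArg Subtype.val he
    have hee := h.pos e he0
    -- For frequency zero, `J e = 0` and the solution is `s • e`, which never returns to `0`.
    by_cases hμ : μ.im = 0
    · exfalso
      have hJe : J e = 0 := by
        by_contra hne
        have := h.apply_map_self he
        simp only [hμ] at this
        linarith [h.pos _ hne]
      have hlin : IsTwistSolution J (fun s ↦ s • e) := by
        have hd : deriv (fun s : ℝ ↦ s • e) = fun _ ↦ e := by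
          ext s
          simpa using ((hasDerivAt_id s).smul_const e).deriv
        exact ⟨by fun_prop, fun s ↦ by simp [hd, hJe], by simp⟩
      have hzl := hz.eq_of_deriv_eq hlin (by
        rw [hze]
        simpa using ((hasDerivAt_id (0 : ℝ)).smul_const e).deriv.symm)
      rw [hzl] at hzt
      simp [ht.ne', he0] at hzt
    · have hl : 0 < |μ.im| := abs_pos.2 hμ
      set l := |μ.im|
      have he : J (J e) = -(l ^ 2) • e := by rw [he, sq_abs]
      have hzl := hz.eq_of_deriv_eq (isTwistSolution_rotatingSolution hl.ne' he) (by
        rw [hze, deriv_rotatingSolution hl.ne']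
        simp)
      rw [hzl, rotatingSolution] at hzt
      -- Pairing with `J e ⊥ e` removes the sine term and isolates `1 - cos (l t)`.
      have h2 := congrArg (fun v ↦ B v (J e)) hzt
      have horth : B e (J e) = 0 := by rw [h.symm, h.apply_self_eq_zero]
      simp only [map_add, map_smul, LinearMap.add_apply, LinearMap.smul_apply, smul_eq_mul, horth,
        h.apply_map_self he, map_zero, LinearMap.zero_apply] at h2
      have hcos : Real.cos (l * t) = 1 := by
        have h3 : (1 - Real.cos (l * t)) / l ^ 2 * (l ^ 2 * B e e) =
            (1 - Real.cos (l * t)) * B e e := by field_simp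
        rw [mul_zero, zero_add, h3] at h2
        rcases mul_eq_zero.1 h2 with h3 | h3
        · linarith
        · exact absurd h3 hee.ne'
      obtain ⟨n, hn⟩ := (Real.cos_eq_one_iff _).1 hcos
      have hn0 : (0 : ℝ) < n := by
        by_contra! hn0
        nlinarith [mul_pos hl ht]
      have hn0' : 0 < n := by exact_mod_cast hn0
      lift n to ℕ using hn0'.le
      refine ⟨l, ⟨hl, e, he0, he⟩, n, by omega, ?_⟩
      push_cast at hn
      field_simp
      linarith
  · rintro ⟨l, ⟨hl, e, he0, he⟩, k, hk, rfl⟩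
    have hee := h.pos e he0
    -- At a quarter period the component along `e` has coefficient `1 / l`, so the solution is not
    -- identically zero.
    refine ⟨_, isTwistSolution_rotatingSolution hl.ne' he, ⟨Real.pi / 2 / l, fun h0 ↦ ?_⟩, ?_⟩
    · have h2 := congrArg (fun v ↦ B v e) h0
      rw [rotatingSolution] at h2
      simp only [map_add, map_smul, LinearMap.add_apply, LinearMap.smul_apply, smul_eq_mul,
        h.apply_self_eq_zero, map_zero, LinearMap.zero_apply, mul_div_cancel₀ _ hl.ne',
        Real.sin_pi_div_two, mul_zero, add_zero] at h2
      exact (mul_pos (one_div_pos.2 hl) hee).ne' h2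
    · rw [rotatingSolution, mul_div_cancel₀ _ hl.ne',
        show 2 * Real.pi * k = k * (2 * Real.pi) by ring, Real.cos_nat_mul_two_pi]
      have : Real.sin (k * (2 * Real.pi)) = 0 := by
        have := Real.sin_nat_mul_pi (k * 2)
        push_cast at this
        rwa [mul_assoc] at this
      simp [this]

end ODE

/-! ### Left invariant vector fields -/

section LeftInvariant

variable {E : Type*} [NormedAddCommGroup E] [NormedSpace ℝ E]
  {N : Type*} [TopologicalSpace N] [ChartedSpace E N] [Group N] [LieGroup 𝓘(ℝ, E) ∞ N]

local notation "𝔏" => GroupLieAlgebra 𝓘(ℝ, E) N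

theorem mdifferentiableAt_mul_left' (g x : N) :
    MDifferentiableAt 𝓘(ℝ, E) 𝓘(ℝ, E) (fun y : N ↦ g * y) x :=
  (contMDiff_mul_left (I := 𝓘(ℝ, E)) (n := ∞)).contMDiffAt.mdifferentiableAt (by simp)

theorem leftPullback_mulInvariantVectorField (g : N) (X : 𝔏) :
    leftPullback g (mulInvariantVectorField X g) = X := by
  have h := mfderiv_comp_apply (I := 𝓘(ℝ, E)) (I' := 𝓘(ℝ, E)) (I'' := 𝓘(ℝ, E)) (1 : N)
    (g := fun y : N ↦ g⁻¹ * y) (f := fun y : N ↦ g * y)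
    (mdifferentiableAt_mul_left' _ _) (mdifferentiableAt_mul_left' _ _) X
  have hc : (fun y : N ↦ g⁻¹ * y) ∘ (fun y : N ↦ g * y) = id := by ext; simp
  rw [hc, mfderiv_id, mul_one] at h
  exact h.symm

theorem mulInvariantVectorField_leftPullback (g : N) (u : TangentSpace 𝓘(ℝ, E) g) :
    mulInvariantVectorField (leftPullback g u) g = u := by
  have h := mfderiv_comp_apply (I := 𝓘(ℝ, E)) (I' := 𝓘(ℝ, E)) (I'' := 𝓘(ℝ, E)) g
    (g := fun y : N ↦ g * y) (f := fun y : N ↦ g⁻¹ * y)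
    (mdifferentiableAt_mul_left' _ _) (mdifferentiableAt_mul_left' _ _) u
  have hc : (fun y : N ↦ g * y) ∘ (fun y : N ↦ g⁻¹ * y) = id := by ext; simp
  rw [hc, mfderiv_id, inv_mul_cancel] at h
  exact h.symm

theorem leftInvariantExtension_mulInvariantVectorField (g : N) (X : 𝔏) :
    leftInvariantExtension g (mulInvariantVectorField X g) = mulInvariantVectorField X := by
  ext y
  rw [leftInvariantExtension, leftPullback_mulInvariantVectorField]

theorem mulInvariantVectorField_injective (g : N) :
    Function.Injective fun X : 𝔏 ↦ mulInvariantVectorField X g :=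
  Function.LeftInverse.injective (leftPullback_mulInvariantVectorField g)

omit [LieGroup 𝓘(ℝ, E) ∞ N] in
theorem mulInvariantVectorField_zero_apply (g : N) :
    mulInvariantVectorField (0 : 𝔏) g = 0 := by
  rw [mulInvariantVectorField]
  exact map_zero _

omit [LieGroup 𝓘(ℝ, E) ∞ N] in
theorem velocity_of_isExpCurve {Z : 𝔏} {γ : ℝ → N} (hγ : IsExpCurve Z γ) (t : ℝ) :
    velocity γ t = mulInvariantVectorField Z (γ t) := by
  rw [velocity, (hγ.2 t).mfderiv]
  exact one_smul ℝ _

/-- The left invariant vector field determined by a vector of the model space. -/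
noncomputable def leftField (x : E) (g : N) : TangentSpace 𝓘(ℝ, E) g :=
  mulInvariantVectorField (I := 𝓘(ℝ, E)) (G := N) x g

omit [LieGroup 𝓘(ℝ, E) ∞ N] in
theorem leftField_add (x y : E) (g : N) : leftField x g + leftField y g = leftField (x + y) g :=
  (congrFun (mulInvariantVectorField_add (I := 𝓘(ℝ, E)) (G := N) x y) g).symm

theorem leftField_eq_zero_iff (x : E) (g : N) : leftField x g = 0 ↔ x = 0 := by
  have h := (mulInvariantVectorField_injective (E := E) g).eq_iff (a := x) (b := (0 : E))
  exact (Eq.congr rfl (mulInvariantVectorField_zero_apply g).symm).trans h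

end LeftInvariant

/-! ### Left invariant metrics in the left invariant frame -/

section Metric

variable {E : Type*} [NormedAddCommGroup E] [NormedSpace ℝ E] [CompleteSpace E]
  {N : Type*} [TopologicalSpace N] [ChartedSpace E N] [Group N] [LieGroup 𝓘(ℝ, E) ∞ N]
  [RiemannianBundle (TangentSpace 𝓘(ℝ, E) : N → Type _)]

local notation "𝔏" => GroupLieAlgebra 𝓘(ℝ, E) N

theorem inner_mulInvariantVectorField (hmetric : IsLeftInvariantMetric 𝓘(ℝ, E) N) (g : N)
    (X Y : 𝔏) : inner ℝ (mulInvariantVectorField X g) (mulInvariantVectorField Y g) =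
      metricForm 𝓘(ℝ, E) N X Y := by
  have h := hmetric g 1 X Y
  -- Left translation by `g` lands in the fibre over `g * 1`, which is only propositionally the
  -- fibre over `g`.
  have hcast : ∀ (h : N), h = g → ∀ u v : E,
      @inner ℝ (TangentSpace 𝓘(ℝ, E) h) _ u v = @inner ℝ (TangentSpace 𝓘(ℝ, E) g) _ u v := by
    rintro _ rfl u v
    rfl
  exact (hcast _ (mul_one g) _ _).symm.trans h

theorem eq_mulInvariantVectorField_of_inner (hmetric : IsLeftInvariantMetric 𝓘(ℝ, E) N) {g : N}
    {u : TangentSpace 𝓘(ℝ, E) g} {X : 𝔏}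
    (h : ∀ W : 𝔏, inner ℝ u (mulInvariantVectorField W g) = metricForm 𝓘(ℝ, E) N X W) :
    u = mulInvariantVectorField X g := by
  refine ext_inner_right ℝ fun v ↦ ?_
  rw [← mulInvariantVectorField_leftPullback g v, h, inner_mulInvariantVectorField hmetric]

end Metric

/-! ### The connection, curvature and Jacobi fields along a central direction -/

section LeviCivita

variable {E : Type*} [NormedAddCommGroup E] [NormedSpace ℝ E] [FiniteDimensional ℝ E]
  [CompleteSpace E]
  {N : Type*} [TopologicalSpace N] [ChartedSpace E N] [Group N] [LieGroup 𝓘(ℝ, E) ∞ N]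
  [RiemannianBundle (TangentSpace 𝓘(ℝ, E) : N → Type _)]
  [IsContMDiffRiemannianBundle 𝓘(ℝ, E) ∞ E (TangentSpace 𝓘(ℝ, E) : N → Type _)]
  {D : CovariantDerivative 𝓘(ℝ, E) E (TangentSpace 𝓘(ℝ, E) : N → Type _)}

local notation "𝔏" => GroupLieAlgebra 𝓘(ℝ, E) N
local notation "𝐁" => metricForm 𝓘(ℝ, E) N
local notation "𝐉" => jExtended (isInnerProduct_metricForm 𝓘(ℝ, E) N)

/-- Left invariant fields have constant inner products, so metric compatibility makes `∇_Y` skew on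
them. -/
theorem IsLeviCivita.inner_add_inner (hD : IsLeviCivita D)
    (hmetric : IsLeftInvariantMetric 𝓘(ℝ, E) N) (g : N) (X Y W : 𝔏) :
    inner ℝ (D (mulInvariantVectorField X) g (mulInvariantVectorField Y g))
      (mulInvariantVectorField W g) +
    inner ℝ (D (mulInvariantVectorField W) g (mulInvariantVectorField Y g))
      (mulInvariantVectorField X g) = 0 := by
  have h := hD.1.mvfderiv_inner_eq (x := g) (mulInvariantVectorField Y)
    (mdifferentiableAt_mulInvariantVectorField X) (mdifferentiableAt_mulInvariantVectorField W)
  simp only [inner_mulInvariantVectorField hmetric] at h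
  rw [real_inner_comm (mulInvariantVectorField X g), ← h]
  simp [mvfderiv]

theorem IsLeviCivita.sub_eq (hD : IsLeviCivita D) (g : N) (X Y : 𝔏) :
    D (mulInvariantVectorField Y) g (mulInvariantVectorField X g) -
      D (mulInvariantVectorField X) g (mulInvariantVectorField Y g) =
        mulInvariantVectorField ⁅X, Y⁆ g := by
  have h := D.torsion_eq_zero_iff.1 hD.2 (mdifferentiableAt_mulInvariantVectorField X (g := g))
    (mdifferentiableAt_mulInvariantVectorField Y)
  rw [h, GroupLieAlgebra.bracket_def, mulInvariantVector_mlieBracket]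

/-- Koszul formula: three torsion and three metric identities combine to `2⟨∇_Z Y, W⟩ = -⟨[Y, W],
Z⟩`, the brackets with `Z` being zero. -/
theorem IsLeviCivita.apply_central (hD : IsLeviCivita D)
    (hmetric : IsLeftInvariantMetric 𝓘(ℝ, E) N) {Z : 𝔏} (hZ : ∀ x : 𝔏, ⁅Z, x⁆ = 0) (g : N)
    (Y : 𝔏) : D (mulInvariantVectorField Y) g (mulInvariantVectorField Z g) =
      mulInvariantVectorField ((-(1 / 2) : ℝ) • 𝐉 Z Y) g := by
  refine eq_mulInvariantVectorField_of_inner hmetric fun W ↦ ?_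
  have htor : ∀ X Y W : 𝔏,
      inner ℝ (D (mulInvariantVectorField Y) g (mulInvariantVectorField X g))
        (mulInvariantVectorField W g) -
      inner ℝ (D (mulInvariantVectorField X) g (mulInvariantVectorField Y g))
        (mulInvariantVectorField W g) = 𝐁 ⁅X, Y⁆ W := fun X Y W ↦ by
    rw [← inner_sub_left, hD.sub_eq, inner_mulInvariantVectorField hmetric]
  have hZ' : ∀ x : 𝔏, ⁅x, Z⁆ = 0 := fun x ↦ by rw [← lie_skew, hZ, neg_zero]
  have t1 := htor Z Y W
  have t2 := htor Y W Z
  have t3 := htor W Z Y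
  have m1 := hD.inner_add_inner hmetric g Y Z W
  have m2 := hD.inner_add_inner hmetric g W Y Z
  have m3 := hD.inner_add_inner hmetric g Z W Y
  rw [hZ] at t1
  rw [hZ'] at t3
  rw [map_smul, LinearMap.smul_apply, jExtended_spec, smul_eq_mul]
  simp only [map_zero, LinearMap.zero_apply] at t1 t3
  linarith

theorem IsLeviCivita.central_apply (hD : IsLeviCivita D)
    (hmetric : IsLeftInvariantMetric 𝓘(ℝ, E) N) {Z : 𝔏} (hZ : ∀ x : 𝔏, ⁅Z, x⁆ = 0) (g : N)
    (Y : 𝔏) : D (mulInvariantVectorField Z) g (mulInvariantVectorField Y g) =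
      mulInvariantVectorField ((-(1 / 2) : ℝ) • 𝐉 Z Y) g := by
  rw [← hD.apply_central hmetric hZ, eq_comm, ← sub_eq_zero, hD.sub_eq, hZ,
    mulInvariantVectorField_zero_apply]

omit [IsContMDiffRiemannianBundle 𝓘(ℝ, E) ∞ E (TangentSpace 𝓘(ℝ, E) : N → Type _)] in
theorem jExtended_self {Z : 𝔏} (hZ : ∀ x : 𝔏, ⁅Z, x⁆ = 0) : 𝐉 Z Z = 0 :=
  (isInnerProduct_metricForm 𝓘(ℝ, E) N).ext fun W ↦ by
    rw [jExtended_spec, hZ]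
    simp

/-- Here `∇_Z Z = 0` and `[Y, Z] = 0`, so only `-∇_Z ∇_Y Z` survives, and each derivative
contributes `-½ J`. -/
theorem IsLeviCivita.curvatureAt_central (hD : IsLeviCivita D)
    (hmetric : IsLeftInvariantMetric 𝓘(ℝ, E) N) {Z : 𝔏} (hZ : ∀ x : 𝔏, ⁅Z, x⁆ = 0) (g : N)
    (Y : 𝔏) : curvatureAt D g (mulInvariantVectorField Y g) (mulInvariantVectorField Z g)
      (mulInvariantVectorField Z g) =
        mulInvariantVectorField ((-(1 / 4) : ℝ) • 𝐉 Z (𝐉 Z Y)) g := by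
  have e1 : (fun y : N ↦ D (mulInvariantVectorField Z) y (mulInvariantVectorField Z y)) = 0 := by
    ext y
    rw [hD.central_apply hmetric hZ, jExtended_self hZ, smul_zero,
      mulInvariantVectorField_zero_apply]
    rfl
  have e2 : (fun y : N ↦ D (mulInvariantVectorField Z) y (mulInvariantVectorField Y y)) =
      mulInvariantVectorField ((-(1 / 2) : ℝ) • 𝐉 Z Y) := by
    ext y
    rw [hD.central_apply hmetric hZ]
  have e3 : VectorField.mlieBracket 𝓘(ℝ, E) (mulInvariantVectorField Y)
      (mulInvariantVectorField Z) g = 0 := by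
    rw [← mulInvariantVector_mlieBracket, ← GroupLieAlgebra.bracket_def, ← lie_skew, hZ, neg_zero,
      mulInvariantVectorField_zero_apply]
  simp only [curvatureAt, leftInvariantExtension_mulInvariantVectorField, curvatureField]
  rw [e1, e2, e3, D.isCovariantDerivativeOn.zero, hD.apply_central hmetric hZ, map_zero, map_smul,
    smul_smul, zero_apply, sub_zero, zero_sub, ← neg_one_smul ℝ,
    ← Pi.smul_apply, ← mulInvariantVectorField_smul, smul_smul]
  norm_num

/-- The endomorphism `J` of the Lie algebra, on the model space. -/
noncomputable def jModel (N : Type*) [TopologicalSpace N] [ChartedSpace E N] [Group N] [LieGroup 𝓘(ℝ, E) ∞ N]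
    [RiemannianBundle (TangentSpace 𝓘(ℝ, E) : N → Type _)] (Z : GroupLieAlgebra 𝓘(ℝ, E) N) :
    Module.End ℝ E :=
  jExtended (isInnerProduct_metricForm 𝓘(ℝ, E) N) Z

/-- The components of a vector field along a curve, with values in the model space. -/
noncomputable def modelComponents (γ : ℝ → N) (Y : (t : ℝ) → TangentSpace 𝓘(ℝ, E) (γ t)) (t : ℝ) : E :=
  frameComponents γ Y t

theorem IsLeviCivita.curvatureAt_leftField (hD : IsLeviCivita D)
    (hmetric : IsLeftInvariantMetric 𝓘(ℝ, E) N) {Z : 𝔏} (hZ : ∀ x : 𝔏, ⁅Z, x⁆ = 0) (g : N)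
    (y : E) : curvatureAt D g (leftField y g) (mulInvariantVectorField Z g)
      (mulInvariantVectorField Z g) =
        leftField ((-(1 / 4) : ℝ) • jModel N Z (jModel N Z y)) g :=
  hD.curvatureAt_central hmetric hZ g y

theorem IsLeviCivita.covDerivAlong_eq (hD : IsLeviCivita D)
    (hmetric : IsLeftInvariantMetric 𝓘(ℝ, E) N) {Z : 𝔏} (hZ : ∀ x : 𝔏, ⁅Z, x⁆ = 0) {γ : ℝ → N}
    (hγ : IsExpCurve Z γ) (Y : (t : ℝ) → TangentSpace 𝓘(ℝ, E) (γ t)) (t : ℝ) :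
    covDerivAlong D γ Y t = leftField
      (deriv (modelComponents γ Y) t + (-(1 / 2) : ℝ) • jModel N Z (modelComponents γ Y t)) (γ t) := by
  rw [covDerivAlong, velocity_of_isExpCurve hγ, hD.apply_central hmetric hZ, ← Pi.add_apply,
    ← mulInvariantVectorField_add]
  rfl

/-- Expanding `(d/dt - ½ J)² y - ¼ J² y` cancels the `J²` terms and leaves `y'' - J y'`. -/
theorem IsLeviCivita.isJacobiField_iff (hD : IsLeviCivita D)
    (hmetric : IsLeftInvariantMetric 𝓘(ℝ, E) N) {Z : 𝔏} (hZ : ∀ x : 𝔏, ⁅Z, x⁆ = 0) {γ : ℝ → N}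
    (hγ : IsExpCurve Z γ) (Y : (t : ℝ) → TangentSpace 𝓘(ℝ, E) (γ t)) :
    IsJacobiField D γ Y ↔ ContDiff ℝ ∞ (modelComponents γ Y) ∧
      ∀ t, deriv (deriv (modelComponents γ Y)) t = jModel N Z (deriv (modelComponents γ Y) t) := by
  refine and_congr_right fun hsmooth ↦ forall_congr' fun t ↦ ?_
  change ContDiff ℝ ∞ (modelComponents γ Y) at hsmooth
  set y := modelComponents γ Y with hy
  set J := jModel N Z with hJ
  have hcomp : modelComponents γ (covDerivAlong D γ Y) =
      fun s ↦ deriv y s + (-(1 / 2) : ℝ) • J (y s) := by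
    ext s
    rw [modelComponents, frameComponents, hD.covDerivAlong_eq hmetric hZ hγ]
    exact leftPullback_mulInvariantVectorField _ _
  have hdy : Differentiable ℝ y := hsmooth.differentiable (by simp)
  have hdy' : Differentiable ℝ (deriv y) :=
    (contDiff_infty_iff_deriv.1 hsmooth).2.differentiable (by simp)
  have hJy : HasDerivAt (fun s ↦ J (y s)) (J (deriv y t)) t :=
    (LinearMap.toContinuousLinearMap J).hasFDerivAt.comp_hasDerivAt t (hdy t).hasDerivAt
  have hderiv : deriv (fun s ↦ deriv y s + (-(1 / 2) : ℝ) • J (y s)) t =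
      deriv (deriv y) t + (-(1 / 2) : ℝ) • J (deriv y t) :=
    ((hdy' t).hasDerivAt.add (hJy.const_smul _)).deriv
  have hY : Y t = leftField (y t) (γ t) :=
    (mulInvariantVectorField_leftPullback _ _).symm
  rw [hD.covDerivAlong_eq hmetric hZ hγ, hcomp, hderiv, velocity_of_isExpCurve hγ, hY,
    hD.curvatureAt_leftField hmetric hZ, leftField_add, leftField_eq_zero_iff]
  change deriv (deriv y) t + (-(1 / 2) : ℝ) • J (deriv y t) +
    (-(1 / 2) : ℝ) • J (deriv y t + (-(1 / 2) : ℝ) • J (y t)) +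
    (-(1 / 4) : ℝ) • J (J (y t)) = 0 ↔ _
  rw [← sub_eq_zero (a := deriv (deriv y) t), map_add, map_smul]
  refine Eq.congr ?_ rfl
  module

/-- The conjugate values along `t ↦ exp (t Z)` with `Z` central. -/
theorem IsLeviCivita.isConjugateValue_iff (hD : IsLeviCivita D)
    (hmetric : IsLeftInvariantMetric 𝓘(ℝ, E) N) {Z : 𝔏} (hZ : ∀ x : 𝔏, ⁅Z, x⁆ = 0) {γ : ℝ → N}
    (hγ : IsExpCurve Z γ) (t : ℝ) :
    IsConjugateValue D γ t ↔
      t ∈ resonanceTimes {l | 0 < l ∧ ∃ e, e ≠ 0 ∧ 𝐉 Z (𝐉 Z e) = -(l ^ 2) • e} := by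
  have hskew : IsSkewFor (V := E) 𝐁 (jModel N Z) :=
    isSkewFor_jExtended (isInnerProduct_metricForm 𝓘(ℝ, E) N) Z
  have hzero : ∀ (Y : (s : ℝ) → TangentSpace 𝓘(ℝ, E) (γ s)) (s : ℝ),
      modelComponents γ Y s = 0 ↔ Y s = 0 := by
    intro Y s
    constructor
    · intro h
      rw [← mulInvariantVectorField_leftPullback (γ s) (Y s)]
      exact (congrArg (fun X : 𝔏 ↦ mulInvariantVectorField X (γ s)) h).trans
        (mulInvariantVectorField_zero_apply _)
    · intro h
      rw [modelComponents, frameComponents, h]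
      exact map_zero (mfderiv 𝓘(ℝ, E) 𝓘(ℝ, E) (fun y : N ↦ (γ s)⁻¹ * y) (γ s))
  constructor
  · rintro ⟨ht, Y, hY, ⟨s, hs⟩, h0, hYt⟩
    rw [hD.isJacobiField_iff hmetric hZ hγ] at hY
    exact (hskew.exists_vanishing_iff ht).1 ⟨modelComponents γ Y,
      ⟨hY.1, hY.2, (hzero Y 0).2 h0⟩, ⟨s, mt (hzero Y s).1 hs⟩, (hzero Y t).2 hYt⟩
  · intro hmem
    have ht : 0 < t := by
      obtain ⟨l, ⟨hl, -⟩, k, hk, rfl⟩ := hmem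
      have := Real.pi_pos
      have : (0 : ℝ) < k := by exact_mod_cast hk
      positivity
    obtain ⟨y, hy, ⟨s, hs⟩, hyt⟩ := (hskew.exists_vanishing_iff ht).2 hmem
    let Y : (s : ℝ) → TangentSpace 𝓘(ℝ, E) (γ s) := fun s ↦ leftField (y s) (γ s)
    have hYy : modelComponents γ Y = y := by
      ext s
      exact leftPullback_mulInvariantVectorField _ _
    refine ⟨ht, Y, ?_, ⟨s, ?_⟩, ?_, ?_⟩
    · rw [hD.isJacobiField_iff hmetric hZ hγ, hYy]
      exact ⟨hy.contDiff, hy.eqn⟩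
    · rwa [Ne, ← hzero, hYy]
    · rw [← hzero, hYy, hy.init]
    · rw [← hzero, hYy, hyt]

end LeviCivita

/-! ### Primitive conjugate values and the spectrum of `j(Z)` -/

theorem proposition5p1
    -- a simply connected Lie group `N` with a left invariant Riemannian metric
    {E : Type*} [NormedAddCommGroup E] [NormedSpace ℝ E] [FiniteDimensional ℝ E] [CompleteSpace E]
    {N : Type*} [TopologicalSpace N] [ChartedSpace E N] [Group N] [LieGroup 𝓘(ℝ, E) ∞ N]
    [SimplyConnectedSpace N]
    [RiemannianBundle (TangentSpace 𝓘(ℝ, E) : N → Type _)]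
    [IsContMDiffRiemannianBundle 𝓘(ℝ, E) ∞ E (TangentSpace 𝓘(ℝ, E) : N → Type _)]
    (hmetric : IsLeftInvariantMetric 𝓘(ℝ, E) N)
    -- its Lie algebra is 2-step nilpotent of type `(p, q)`
    (hnil : IsTwoStepNilpotent (GroupLieAlgebra 𝓘(ℝ, E) N))
    (p q : ℕ) (htype : IsOfType (GroupLieAlgebra 𝓘(ℝ, E) N) p q)
    -- its Levi-Civita connection
    (D : CovariantDerivative 𝓘(ℝ, E) E (TangentSpace 𝓘(ℝ, E) : N → Type _))
    (hD : IsLeviCivita D)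
    -- the geodesic `γ_Z(t) = exp (t Z)`
    (Z : GroupLieAlgebra 𝓘(ℝ, E) N)
    (hZ : Z ∈ commutatorSubspace (GroupLieAlgebra 𝓘(ℝ, E) N)) (hZ0 : Z ≠ 0)
    (γ : ℝ → N) (hγ : IsExpCurve Z γ)
    -- the eigenvalues of `j(Z)` with multiplicities
    (eigs : Multiset ℂ)
    (heigs : eigs = jEigenvalues (isInnerProduct_metricForm 𝓘(ℝ, E) N) Z) :
    -- 1) there are at most `⌊q / 2⌋` primitive conjugate values
    (primitiveConjugateValues D γ).encard ≤ ((q / 2 : ℕ) : ℕ∞) ∧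
    -- 2) when there are exactly `⌊q / 2⌋` of them
    ((primitiveConjugateValues D γ).encard = ((q / 2 : ℕ) : ℕ∞) ↔
      eigs.Nodup ∧ ∀ μ ∈ eigs, ∀ ν ∈ eigs, μ ≠ ν → μ ≠ 0 → ν ≠ 0 →
        ∀ m : ℤ, 2 ≤ |m| → μ / ν ≠ (m : ℂ)) ∧
    -- 3) what they are in that case
    (∀ t : Fin (q / 2) → ℝ, Function.Injective t →
      (∀ k, t k ∈ primitiveConjugateValues D γ) →
      ∃ lam : Fin (q / 2) → ℝ,
        (∀ k, 0 < lam k ∧ t k = 2 * Real.pi / lam k ∧ (lam k : ℂ) * Complex.I ∈ eigs) ∧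
        {μ : ℂ | μ ∈ eigs ∧ μ ≠ 0} =
          {μ : ℂ | ∃ k, μ = (lam k : ℂ) * Complex.I ∨ μ = -((lam k : ℂ) * Complex.I)}) ∧
    -- 4) in that case the conjugate values determine all eigenvalues and their multiplicities
    ((primitiveConjugateValues D γ).encard = ((q / 2 : ℕ) : ℕ∞) →
      eigs.Nodup ∧ (0 ∈ eigs ↔ Odd q) ∧
      {μ : ℂ | μ ∈ eigs ∧ μ ≠ 0} =
        {μ : ℂ | ∃ t ∈ primitiveConjugateValues D γ,
          μ = ((2 * Real.pi / t : ℝ) : ℂ) * Complex.I ∨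
            μ = -(((2 * Real.pi / t : ℝ) : ℂ) * Complex.I)}) := by
  subst heigs
  have hB := isInnerProduct_metricForm 𝓘(ℝ, E) N
  have hcentral := fun x ↦ hnil.lie_eq_zero hZ x
  have hspec : IsSkewSpectrum (jEigenvalues hB Z) q :=
    htype.2 ▸ isSkewSpectrum_jEigenvalues hB Z
  refine hspec.primitiveElements_conclusion ?_
  -- All the geometry enters through this description of the conjugate values; what follows from it
  -- is the combinatorics of the spectrum.
  have hconj : ∀ t, IsConjugateValue D γ t ↔
      t ∈ resonanceTimes (positiveFrequencies (jEigenvalues hB Z)) := fun t ↦ by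
    rw [positiveFrequencies_jEigenvalues hB hnil, hD.isConjugateValue_iff hmetric hcentral hγ]
  simp only [primitiveConjugateValues, primitiveElements, hconj]
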